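/- Let $\mathbb K=\mathbb R$ or $\mathbb C$, and let $E$ and $F$ be Banach spaces over $\mathbb K$. For a $\mathbb K$-Banach space $B$, let $\mathrm{Ext}_B$ be the set of extreme points of the closed unit ball of its dual. A bounded linear operator $T:B\to B$ is a multiplier if there is a function $a_T:\mathrm{Ext}_B\to\mathbb K$ with $p\circ T=a_T(p)\,p$ for every $p\in\mathrm{Ext}_B$. A multiplier $S$ is an adjoint for a multiplier $T$ if $a_S=\overline{a_T}$. The centralizer $Z(B)$ is the space of all multipliers on $B$ that have an adjoint. For an $E$-valued function $f$ on $X$, put $c(f)=\{x\in X: f(x)\neq 0\}$. A map $T$ between spaces of vector-valued functions is separating if it is additive and $c(Tf)\cap c(Tg)=\emptyset$ whenever $c(f)\cap c(g)=\emptyset$; it is biseparating if it is bijective and both $T$ and $T^{-1}$ are separating. **Proposition.** Suppose that $Z(E)$ and $Z(F)$ are one-dimensional over $\mathbb K$. 1. Let $X$ and $Y$ be realcompact completely regular Hausdorff spaces and let $E$ and $F$ be infinite-dimensional. Then every surjective $\mathbb K$-linear isometry $T: C_b(X,E)\to C_b(Y,F)$ between the spaces of bounded continuous functions, with the sup norm,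 is biseparating. 2. Let $X$ and $Y$ be complete metric spaces. Then every surjective $\mathbb K$-linear isometry $T: C_b^u(X,E)\to C_b^u(Y,F)$ between the spaces of bounded uniformly continuous functions, with the sup norm, is biseparating. -/

import Mathlib

open scoped BoundedContinuousFunction ComplexConjugate

namespace BanachStone

section Centralizer

/-- `Ext_B`: the extreme points of the closed unit ball of the dual of `B`. -/
def extDual (K B : Type*) [RCLike K] [NormedAddCommGroup B] [NormedSpace K B] :
    Set (StrongDual K B) :=
  Set.extremePoints ℝ (Metric.closedBall (0 : StrongDual K B) 1)

/-- `a` is an eigenvalue function `a_T` of `T`: `p ∘ T = a(p) p` for all `p` in `Ext_B`. -/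
def IsEigenvalueFunction {K B : Type*} [RCLike K] [NormedAddCommGroup B] [NormedSpace K B]
    (T : B →L[K] B) (a : extDual K B → K) : Prop :=
  ∀ (p : extDual K B) (x : B), (p : StrongDual K B) (T x) = a p * (p : StrongDual K B) x

/-- `T` is a multiplier: every `p` in `Ext_B` is an eigenvector of the transpose of `T`. -/
def IsMultiplier {K B : Type*} [RCLike K] [NormedAddCommGroup B] [NormedSpace K B]
    (T : B →L[K] B) : Prop :=
  ∃ a : extDual K B → K, IsEigenvalueFunction T a

/-- `S` is an adjoint of `T`: both are multipliers, and `a_S` is the complex conjugate of `a_T`. -/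
def IsMultiplierAdjoint {K B : Type*} [RCLike K] [NormedAddCommGroup B] [NormedSpace K B]
    (T S : B →L[K] B) : Prop :=
  ∃ a : extDual K B → K, IsEigenvalueFunction T a ∧ IsEigenvalueFunction S (fun p => conj (a p))

/-- The centralizer `Z(B)`: the multipliers that have an adjoint. It is a linear subspace of the
space of bounded linear operators on `B`. -/
def centralizer (K B : Type*) [RCLike K] [NormedAddCommGroup B] [NormedSpace K B] :
    Submodule K (B →L[K] B) where
  carrier := {T | IsMultiplier T ∧ ∃ S : B →L[K] B, IsMultiplierAdjoint T S}
  zero_mem' := by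
    have h : IsEigenvalueFunction (0 : B →L[K] B) (fun _ => 0) := fun p x => by simp
    exact ⟨⟨_, h⟩, 0, _, h, by simpa using h⟩
  add_mem' := by
    rintro T₁ T₂ ⟨-, S₁, a₁, hT₁, hS₁⟩ ⟨-, S₂, a₂, hT₂, hS₂⟩
    have h : IsEigenvalueFunction (T₁ + T₂) (fun p => a₁ p + a₂ p) := fun p x => by
      simp [hT₁ p x, hT₂ p x, add_mul]
    refine ⟨⟨_, h⟩, S₁ + S₂, _, h, fun p x => ?_⟩
    simp [hS₁ p x, hS₂ p x, add_mul]
  smul_mem' := by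
    rintro c T ⟨-, S, a, hT, hS⟩
    have h : IsEigenvalueFunction (c • T) (fun p => c * a p) := fun p x => by
      simp [hT p x, mul_assoc]
    refine ⟨⟨_, h⟩, conj c • S, _, h, fun p x => ?_⟩
    simp [hS p x, mul_assoc]

end Centralizer

section FunctionSpaces

/-- `X` is realcompact: every real maximal ideal `M` of the ring of continuous real-valued
functions on `X` (that is, the canonical copy of `ℝ` is all of the residue field) is fixed
(that is, all its members vanish at some common point of `X`). -/
def IsRealcompact (X : Type*) [TopologicalSpace X] : Prop :=
  ∀ M : Ideal C(X, ℝ), M.IsMaximal →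
    Function.Surjective (algebraMap ℝ (C(X, ℝ) ⧸ M)) → ∃ x : X, ∀ f ∈ M, f x = 0

/-- `C_b^u(X, E)`: the bounded uniformly continuous functions, as a subspace of `C_b(X, E)`; it
carries the sup norm. -/
def boundedUniform (K X E : Type*) [RCLike K] [UniformSpace X] [NormedAddCommGroup E]
    [NormedSpace K E] : Submodule K (X →ᵇ E) where
  carrier := {f | UniformContinuous f}
  zero_mem' := uniformContinuous_const
  add_mem' hf hg := UniformContinuous.add hf hg
  smul_mem' c _ hf := UniformContinuous.const_smul hf c

instance boundedUniformFunLike (K X E : Type*) [RCLike K] [UniformSpace X] [NormedAddCommGroup E]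
    [NormedSpace K E] : FunLike (boundedUniform K X E) X E where
  coe f := ⇑(f : X →ᵇ E)
  coe_injective _ _ h := Subtype.ext (DFunLike.coe_injective h)

/-- The cozero set of a function. -/
def cozero {X E : Type*} [Zero E] (f : X → E) : Set X := {x | f x ≠ 0}

/-- A map between function spaces is separating if it is additive and sends functions with
disjoint cozero sets to functions with disjoint cozero sets. -/
def IsSeparating {A B X Y E F : Type*} [FunLike A X E] [FunLike B Y F] [Add A] [Add B]
    [Zero E] [Zero F] (T : A → B) : Prop :=
  (∀ f g : A, T (f + g) = T f + T g) ∧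
    ∀ f g : A, cozero f ∩ cozero g = ∅ → cozero (T f) ∩ cozero (T g) = ∅

/-- A map between function spaces is biseparating if it is bijective, and both it and its inverse
are separating. -/
def IsBiseparating {A B X Y E F : Type*} [FunLike A X E] [FunLike B Y F] [Add A] [Add B]
    [Zero E] [Zero F] (T : A → B) : Prop :=
  IsSeparating T ∧
    ∃ S : B → A, Function.LeftInverse S T ∧ Function.RightInverse S T ∧ IsSeparating S

end FunctionSpaces

end BanachStone

/-! Multiplication by a function with values in `[0, 1]` leaves its trace on the norm: it is a
convex weight, and this property involves no points of `X`. For a convex weight `M` the norms of `P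
∘ M` and `P ∘ (1 - M)` add up to at most `‖P‖`, so an extreme `P` must be an eigenvector of the
transpose of `M`, with real eigenvalue (`IsConvexWeight.exists_eigenvalue`).

If `p` is extreme for `F`, then `g ↦ p (g y)` is extreme on the function space
(`IsLocalModule.evalDual_mem_extDual`), and so is its pullback along the isometry `T`. Hence `T M
T⁻¹`, applied to constants and evaluated at `y`, is an operator on `F` with real eigenvalues. It is
its own adjoint, lies in `Z(F)`, and is a scalar `c`; thus `T (M f) y = c • T f y` for all `f`.

For `f`, `g` with disjoint cozero sets, a truncation of `‖f‖/ε` as multiplier kills `g` and moves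
`f` by at most `ε`. If `T g y ≠ 0`, then `c = 0` and `‖T f y‖ ≤ ε`. The same applies to `T⁻¹`. Both
kinds of function spaces are handled at once through `IsLocalModule`. -/

namespace BanachStone

/-! ### Extreme functionals, convex weights and the centralizer -/

section ExtremeFunctionals

variable {K B C : Type*} [RCLike K] [NormedAddCommGroup B] [NormedSpace K B]
  [NormedAddCommGroup C] [NormedSpace K C]

theorem mem_extDual_iff {P : StrongDual K B} :
    P ∈ extDual K B ↔ ‖P‖ ≤ 1 ∧ ∀ Q R : StrongDual K B, ‖Q‖ ≤ 1 → ‖R‖ ≤ 1 →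
      ∀ s t : ℝ, 0 < s → 0 < t → s + t = 1 → s • Q + t • R = P → Q = P := by
  simp only [extDual, mem_extremePoints_iff_left, mem_closedBall_zero_iff]
  refine and_congr_right fun _ => ⟨fun h Q R hQ hR s t hs ht hst e => ?_, fun h Q hQ R hR => ?_⟩
  · exact h Q hQ R hR ⟨s, t, hs, ht, hst, e⟩
  · rintro ⟨s, t, hs, ht, hst, e⟩
    exact h Q R hQ hR s t hs ht hst e

/-- If `‖P‖ < 1`, then `P` is the midpoint of `P ± (1 - ‖P‖) q` for any norm-one functional `q`. -/
theorem norm_eq_one_of_mem_extDual [Nontrivial B] {P : StrongDual K B} (hP : P ∈ extDual K B) :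
    ‖P‖ = 1 := by
  obtain ⟨h1, h2⟩ := mem_extDual_iff.1 hP
  by_contra hne
  have hlt : ‖P‖ < 1 := lt_of_le_of_ne h1 hne
  obtain ⟨x, hx⟩ := exists_ne (0 : B)
  obtain ⟨q, hq, hqx⟩ := exists_dual_vector K x (norm_ne_zero_iff.2 hx)
  have hd : 0 < (1 - ‖P‖) := by linarith
  have hn : ∀ r : ℝ, ‖r • q‖ = |r| := fun r => by rw [norm_smul, hq, mul_one, Real.norm_eq_abs]
  have hle : ∀ r : ℝ, |r| ≤ 1 - ‖P‖ → ‖P + r • q‖ ≤ 1 := fun r hr => by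
    have := norm_add_le P (r • q)
    rw [hn] at this
    linarith
  have h3 := h2 (P + (1 - ‖P‖) • q) (P + (-(1 - ‖P‖)) • q)
    (hle _ (by rw [abs_of_pos hd])) (hle _ (by rw [abs_neg, abs_of_pos hd]))
    (1 / 2) (1 / 2) (by norm_num) (by norm_num) (by norm_num) (by module)
  have h4 : ‖(1 - ‖P‖) • q‖ = 0 := by
    rw [add_eq_left.1 h3, norm_zero]
  rw [hn, abs_of_pos hd] at h4
  linarith

theorem comp_mem_extDual (e : B ≃ₗᵢ[K] C) {P : StrongDual K C} (hP : P ∈ extDual K C) :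
    P.comp (e.toContinuousLinearEquiv : B →L[K] C) ∈ extDual K B := by
  obtain ⟨h1, h2⟩ := mem_extDual_iff.1 hP
  have hle : ∀ Q : StrongDual K B, ‖Q‖ ≤ 1 →
      ‖Q.comp (e.symm.toContinuousLinearEquiv : C →L[K] B)‖ ≤ 1 := by
    intro Q h1
    refine ContinuousLinearMap.opNorm_le_bound _ zero_le_one fun x => ?_
    have := Q.le_of_opNorm_le h1 (e.symm x)
    rwa [e.symm.norm_map] at this
  refine mem_extDual_iff.2 ⟨?_, fun Q R hQ hR s t hs ht hst h => ?_⟩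
  · refine ContinuousLinearMap.opNorm_le_bound _ zero_le_one fun x => ?_
    have := P.le_of_opNorm_le h1 (e x)
    rwa [e.norm_map] at this
  · have h3 := h2 _ _ (hle Q hQ) (hle R hR) s t hs ht hst (by
      ext x
      simpa using congrArg (fun Φ : StrongDual K B => Φ (e.symm x)) h)
    ext x
    simpa using congrArg (fun Φ : StrongDual K C => Φ (e x)) h3

/-- By the Krein–Milman theorem, the extreme functionals separate the points of a normed space. -/
theorem eq_zero_of_forall_extDual {v : B} (h : ∀ p ∈ extDual K B, p v = 0) : v = 0 := by
  by_contra hv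
  -- The functionals in the dual ball norming `v` form a weak-* compact face, so an extreme point of
  -- `S` is extreme in the whole ball.
  let S : Set (WeakDual K B) :=
    WeakDual.toStrongDual ⁻¹' Metric.closedBall (0 : StrongDual K B) 1 ∩
      {p : WeakDual K B | RCLike.re (p v) = ‖v‖}
  have hS : IsCompact S := by
    refine (WeakDual.isCompact_closedBall (𝕜 := K) (E := B) 0 1).inter_right ?_
    exact isClosed_eq (RCLike.continuous_re.comp (WeakDual.eval_continuous v)) continuous_const
  have hne : S.Nonempty := by
    obtain ⟨q, hq, hqv⟩ := exists_dual_vector K v (norm_ne_zero_iff.2 hv)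
    refine ⟨StrongDual.toWeakDual q, ?_, ?_⟩
    · simp [hq]
    · simp [hqv]
  have : LocallyConvexSpace ℝ (WeakDual K B) :=
    inferInstanceAs (LocallyConvexSpace ℝ (WeakBilin (topDualPairing K B)))
  obtain ⟨p, hp⟩ := hS.extremePoints_nonempty hne
  obtain ⟨⟨hp1, hp2⟩, hp3⟩ := mem_extremePoints_iff_left.1 hp
  have hre : ∀ Q : StrongDual K B, ‖Q‖ ≤ 1 → RCLike.re (Q v) ≤ ‖v‖ := fun Q hQ =>
    (RCLike.re_le_norm _).trans (by simpa using Q.le_of_opNorm_le hQ v)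
  have hpe : WeakDual.toStrongDual p ∈ extDual K B := by
    refine mem_extDual_iff.2 ⟨by simpa using hp1, fun Q R hQ hR s t hs ht hst e => ?_⟩
    have hv' : s * RCLike.re (Q v) + t * RCLike.re (R v) = ‖v‖ := by
      have := congrArg (fun Φ : StrongDual K B => RCLike.re (Φ v)) e
      simp only [add_apply, smul_apply, map_add,
        RCLike.smul_re] at this
      exact this.trans hp2
    have hQs := mul_le_mul_of_nonneg_left (hre Q hQ) hs.le
    have hRt := mul_le_mul_of_nonneg_left (hre R hR) ht.le
    have hsum : s * ‖v‖ + t * ‖v‖ = ‖v‖ := by rw [← add_mul, hst, one_mul]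
    have hQv : RCLike.re (Q v) = ‖v‖ := mul_left_cancel₀ hs.ne' (by linarith)
    have hRv : RCLike.re (R v) = ‖v‖ := mul_left_cancel₀ ht.ne' (by linarith)
    exact hp3 (StrongDual.toWeakDual Q) ⟨by simpa using hQ, hQv⟩ (StrongDual.toWeakDual R)
      ⟨by simpa using hR, hRv⟩ ⟨s, t, hs, ht, hst, e⟩
  have h0 : RCLike.re (p v) = ‖v‖ := hp2
  have h1 : p v = 0 := h _ hpe
  rw [h1, map_zero] at h0
  exact hv (norm_eq_zero.1 h0.symm)

/-- `M` is a convex weight: `M f + (1 - M) g` is never larger than both `f` and `g`. -/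
def IsConvexWeight (M : B →L[K] B) : Prop :=
  ∀ f g : B, ‖M f + (g - M g)‖ ≤ max ‖f‖ ‖g‖

/-- Unimodular factors on `f` and `g` make `P (M f)` and `P (g - M g)` nonnegative, so their moduli
add up inside a single value of `P`. The suprema over `f` and `g` are then independent. -/
theorem IsConvexWeight.norm_comp_add_norm_comp_le {M : B →L[K] B} (hM : IsConvexWeight M)
    (P : StrongDual K B) :
    ‖P.comp M‖ + ‖P.comp (ContinuousLinearMap.id K B - M)‖ ≤ ‖P‖ := by
  have hrot : ∀ z : K, ∃ c : K, ‖c‖ = 1 ∧ c * z = (‖z‖ : K) := by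
    intro z
    by_cases hz : z = 0
    · exact ⟨1, by simp, by simp [hz]⟩
    · have hz' : ‖z‖ ≠ 0 := norm_ne_zero_iff.2 hz
      refine ⟨(‖z‖ : K) / z, by simp [hz'], div_mul_cancel₀ _ hz⟩
  have key : ∀ f g : B, ‖f‖ ≤ 1 → ‖g‖ ≤ 1 → ‖P (M f)‖ + ‖P (g - M g)‖ ≤ ‖P‖ := by
    intro f g hf hg
    obtain ⟨c, hc, hcf⟩ := hrot (P (M f))
    obtain ⟨d, hd, hdg⟩ := hrot (P (g - M g))
    have h1 := hM (c • f) (d • g)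
    have h2 : P (M (c • f) + (d • g - M (d • g))) =
        ((‖P (M f)‖ + ‖P (g - M g)‖ : ℝ) : K) := by
      rw [map_smul, map_smul, ← smul_sub, map_add, map_smul, map_smul, smul_eq_mul, smul_eq_mul,
        hcf, hdg]
      push_cast
      rfl
    have h3 := P.le_opNorm (M (c • f) + (d • g - M (d • g)))
    rw [h2, RCLike.norm_ofReal, abs_of_nonneg (by positivity)] at h3
    rw [norm_smul, norm_smul, hc, hd, one_mul, one_mul] at h1
    exact h3.trans (mul_le_of_le_one_right (norm_nonneg _) (h1.trans (max_le hf hg)))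
  have hsup : ∀ (Q : StrongDual K B) (r : ℝ), (∀ f, ‖f‖ ≤ 1 → ‖Q f‖ ≤ r) → ‖Q‖ ≤ r := by
    intro Q r hQ
    rw [← Q.sSup_unitClosedBall_eq_norm]
    refine csSup_le ⟨_, 0, by simp, rfl⟩ ?_
    rintro _ ⟨f, hf, rfl⟩
    exact hQ f (by simpa using hf)
  have h1 : ‖P.comp M‖ ≤ ‖P‖ - ‖P.comp (ContinuousLinearMap.id K B - M)‖ := by
    refine hsup _ _ fun f hf => ?_
    have h2 : ‖P.comp (ContinuousLinearMap.id K B - M)‖ ≤ ‖P‖ - ‖P (M f)‖ := by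
      refine hsup _ _ fun g hg => ?_
      have := key f g hf hg
      simp only [ContinuousLinearMap.comp_apply, sub_apply,
        ContinuousLinearMap.id_apply]
      linarith
    rw [ContinuousLinearMap.comp_apply]
    linarith
  linarith

/-- Every extreme functional is an eigenvector of the transpose of a convex weight. -/
theorem IsConvexWeight.exists_eigenvalue {M : B →L[K] B} (hM : IsConvexWeight M)
    {P : StrongDual K B} (hP : P ∈ extDual K B) : ∃ r : ℝ, ∀ f, P (M f) = (r : K) * P f := by
  obtain ⟨h1, h2⟩ := mem_extDual_iff.1 hP
  have hadd := (hM.norm_comp_add_norm_comp_le P).trans h1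
  set s := ‖P.comp M‖ with hs
  set Q := P.comp (ContinuousLinearMap.id K B - M) with hQ
  rcases (norm_nonneg (P.comp M)).eq_or_lt with h0 | h0
  · refine ⟨0, fun f => ?_⟩
    have : P.comp M = 0 := norm_eq_zero.1 h0.symm
    simpa using congrArg (fun Φ : StrongDual K B => Φ f) this
  rw [← hs] at h0
  rcases le_or_gt 1 s with h3 | h3
  · refine ⟨1, fun f => ?_⟩
    have : Q = 0 := norm_le_zero_iff.1 (by linarith)
    have := congrArg (fun Φ : StrongDual K B => Φ f) this
    simp only [hQ, ContinuousLinearMap.comp_apply, sub_apply,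
        ContinuousLinearMap.id_apply, map_sub, zero_apply] at this
    rw [RCLike.ofReal_one, one_mul]
    exact (sub_eq_zero.1 this).symm
  -- Here `P = s • (s⁻¹ • P ∘ M) + (1 - s) • ((1 - s)⁻¹ • Q)` is a proper convex combination in the
  -- ball, so extremality gives `P ∘ M = s • P`.
  · have h4 : 0 < 1 - s := by linarith
    have h5 := h2 (s⁻¹ • P.comp M) ((1 - s)⁻¹ • Q)
      (by rw [norm_smul, norm_inv, Real.norm_of_nonneg h0.le, ← hs, inv_mul_cancel₀ h0.ne'])
      (by
        rw [norm_smul, norm_inv, Real.norm_of_nonneg h4.le, inv_mul_le_iff₀ h4]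
        linarith)
      s (1 - s) h0 h4 (by ring) (by
        rw [smul_inv_smul₀ h0.ne', smul_inv_smul₀ h4.ne', hQ]
        ext f
        simp)
    refine ⟨s, fun f => ?_⟩
    have := congrArg (fun Φ : StrongDual K B => (s • Φ) f) h5
    simp only [smul_inv_smul₀ h0.ne'] at this
    rw [ContinuousLinearMap.comp_apply, smul_apply,
      RCLike.real_smul_eq_coe_mul] at this
    exact this

/-- In a space with one-dimensional centralizer, an operator all of whose eigenvalues on the
extreme functionals are real is a scalar. -/
theorem exists_eq_smul_of_finrank_centralizer
    (hB : Module.finrank K (centralizer K B) = 1) {N : B →L[K] B}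
    (hN : ∀ p ∈ extDual K B, ∃ r : ℝ, ∀ v, p (N v) = (r : K) * p v) :
    ∃ c : K, ∀ v, N v = c • v := by
  have hone : ∀ p : extDual K B, ∀ x : B,
      (p : StrongDual K B) (ContinuousLinearMap.id K B x) = 1 * (p : StrongDual K B) x := by simp
  have hidmem : ContinuousLinearMap.id K B ∈ centralizer K B :=
    ⟨⟨fun _ => 1, hone⟩, ContinuousLinearMap.id K B, fun _ => 1, hone,
      fun p x => by simp⟩
  choose a ha using fun p : extDual K B => hN p p.2
  have haN : IsEigenvalueFunction N fun p => (a p : K) := fun p x => ha p x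
  have hNmem : N ∈ centralizer K B :=
    ⟨⟨_, haN⟩, N, _, haN, by simpa using haN⟩
  have hne : (⟨ContinuousLinearMap.id K B, hidmem⟩ : centralizer K B) ≠ 0 := by
    intro h0
    have hz : ∀ x : B, x = 0 := fun x => by
      simpa using congrArg (fun M : centralizer K B => (M : B →L[K] B) x) h0
    have : Subsingleton (centralizer K B) :=
      ⟨fun M N => Subtype.ext (ContinuousLinearMap.ext fun x => by rw [hz (M.1 x), hz (N.1 x)])⟩
    rw [Module.finrank_zero_of_subsingleton] at hB
    exact zero_ne_one hB
  obtain ⟨c, hc⟩ := (finrank_eq_one_iff_of_nonzero' _ hne).1 hB ⟨N, hNmem⟩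
  refine ⟨c, fun v => ?_⟩
  simpa using (congrArg (fun M : centralizer K B => (M : B →L[K] B) v) hc).symm

theorem nontrivial_of_finrank_centralizer (hB : Module.finrank K (centralizer K B) = 1) :
    Nontrivial B := by
  by_contra h
  rw [not_nontrivial_iff_subsingleton] at h
  have : Subsingleton (centralizer K B) :=
    ⟨fun M N => Subtype.ext (ContinuousLinearMap.ext fun x => Subsingleton.elim _ _)⟩
  rw [Module.finrank_zero_of_subsingleton] at hB
  exact zero_ne_one hB

end ExtremeFunctionals

/-! ### Function spaces stable under truncated multipliers -/

section FunctionModules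

/-- Truncation of a real number to the unit interval. -/
def unitClamp (t : ℝ) : ℝ := max 0 (min 1 t)

theorem unitClamp_nonneg (t : ℝ) : 0 ≤ unitClamp t := le_max_left _ _

theorem unitClamp_le_one (t : ℝ) : unitClamp t ≤ 1 := max_le zero_le_one (min_le_left _ _)

theorem unitClamp_of_nonpos {t : ℝ} (ht : t ≤ 0) : unitClamp t = 0 :=
  max_eq_left ((min_le_right _ _).trans ht)

theorem unitClamp_of_one_le {t : ℝ} (ht : 1 ≤ t) : unitClamp t = 1 := by
  rw [unitClamp, min_eq_left ht, max_eq_right zero_le_one]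

theorem lipschitzWith_unitClamp : LipschitzWith 1 unitClamp :=
  (LipschitzWith.id.const_min 1).const_max 0

variable {K A B X Y E F : Type*} [RCLike K] [TopologicalSpace X] [TopologicalSpace Y]
  [NormedAddCommGroup E] [NormedSpace K E] [NormedAddCommGroup F] [NormedSpace K F]
  [NormedAddCommGroup A] [NormedSpace K A] [NormedAddCommGroup B] [NormedSpace K B]

/-- The image of `J` contains the constants and is stable under multiplication by truncated affine
functions of the norms of its members. -/
structure IsLocalModule (J : A →ₗᵢ[K] (X →ᵇ E)) : Prop where
  const : ∀ v : E, ∃ a, ∀ x, J a x = v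
  mul : ∀ (α β : ℝ) (a b : A), ∃ c, ∀ x, J c x = (unitClamp (α + β * ‖J a x‖) : K) • J b x

variable {J : A →ₗᵢ[K] (X →ᵇ E)} {I : B →ₗᵢ[K] (Y →ᵇ F)}

/-- Injectivity of `J` makes the chosen preimages unique, hence linear in `v`. -/
theorem IsLocalModule.exists_const (hJ : IsLocalModule J) :
    ∃ C : E →L[K] A, ∀ v x, J (C v) x = v := by
  choose c hc using hJ.const
  refine ⟨LinearMap.mkContinuous
    { toFun := c
      map_add' := fun v w => J.injective (BoundedContinuousFunction.ext fun x => by simp [hc])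
      map_smul' := fun r v => J.injective (BoundedContinuousFunction.ext fun x => by simp [hc]) }
    1 fun v => ?_, hc⟩
  rw [one_mul, ← J.norm_map]
  exact (BoundedContinuousFunction.norm_le (norm_nonneg v)).2 fun x => (congrArg norm (hc v x)).le

theorem IsLocalModule.exists_mul (hJ : IsLocalModule J) (α β : ℝ) (a : A) :
    ∃ M : A →L[K] A, ∀ b x, J (M b) x = (unitClamp (α + β * ‖J a x‖) : K) • J b x := by
  choose c hc using hJ.mul α β a
  refine ⟨LinearMap.mkContinuous
    { toFun := c
      map_add' := fun v w => J.injective (BoundedContinuousFunction.ext fun x => by simp [hc])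
      map_smul' := fun r v => J.injective (BoundedContinuousFunction.ext fun x => by
        simp [hc, smul_comm r]) }
    1 fun v => ?_, hc⟩
  rw [one_mul, ← J.norm_map]
  refine (BoundedContinuousFunction.norm_le (norm_nonneg v)).2 fun x => ?_
  rw [LinearMap.coe_mk, AddHom.coe_mk, hc, norm_smul, RCLike.norm_ofReal,
    abs_of_nonneg (unitClamp_nonneg _)]
  refine (mul_le_of_le_one_left (norm_nonneg _) (unitClamp_le_one _)).trans ?_
  rw [← J.norm_map]
  exact (J v).norm_coe_le_norm x

theorem isConvexWeight_of_apply_eq {M : A →L[K] A} {h : X → ℝ} (h0 : ∀ x, 0 ≤ h x)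
    (h1 : ∀ x, h x ≤ 1) (hM : ∀ b x, J (M b) x = (h x : K) • J b x) : IsConvexWeight M := by
  intro f g
  rw [← J.norm_map]
  refine (BoundedContinuousFunction.norm_le (by positivity)).2 fun x => ?_
  have e : J (M f + (g - M g)) x = (h x : K) • J f x + ((1 - h x : ℝ) : K) • J g x := by
    simp only [map_add, map_sub, BoundedContinuousFunction.add_apply,
      BoundedContinuousFunction.sub_apply, hM, RCLike.ofReal_one]
    module
  rw [e]
  refine (norm_add_le _ _).trans ?_
  rw [norm_smul, norm_smul, RCLike.norm_ofReal, RCLike.norm_ofReal, abs_of_nonneg (h0 x),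
    abs_of_nonneg (sub_nonneg.2 (h1 x))]
  have hf : ‖J f x‖ ≤ max ‖f‖ ‖g‖ :=
    ((J f).norm_coe_le_norm x).trans (by rw [J.norm_map]; exact le_max_left _ _)
  have hg : ‖J g x‖ ≤ max ‖f‖ ‖g‖ :=
    ((J g).norm_coe_le_norm x).trans (by rw [J.norm_map]; exact le_max_right _ _)
  nlinarith [mul_le_mul_of_nonneg_left hf (h0 x),
    mul_le_mul_of_nonneg_left hg (sub_nonneg.2 (h1 x))]

/-- The evaluation functional `f ↦ p (f x)`. -/
noncomputable def evalDual (J : A →ₗᵢ[K] (X →ᵇ E)) (x : X) (p : StrongDual K E) : StrongDual K A :=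
  (p.comp (BoundedContinuousFunction.evalCLM K x)).comp J.toContinuousLinearMap

@[simp]
theorem evalDual_apply (x : X) (p : StrongDual K E) (f : A) : evalDual J x p f = p (J f x) := rfl

/-- Evaluating at a point and then applying an extreme functional is extreme. -/
theorem IsLocalModule.evalDual_mem_extDual [Nontrivial E] (hJ : IsLocalModule J) (x : X)
    {p : StrongDual K E} (hp : p ∈ extDual K E) : evalDual J x p ∈ extDual K A := by
  have hp1 := norm_eq_one_of_mem_extDual hp
  obtain ⟨-, hp2⟩ := mem_extDual_iff.1 hp
  obtain ⟨C, hC⟩ := hJ.exists_const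
  have hCn : ∀ v, ‖C v‖ ≤ ‖v‖ := fun v => by
    rw [← J.norm_map]
    exact (BoundedContinuousFunction.norm_le (norm_nonneg v)).2 fun x => (congrArg norm (hC v x)).le
  refine mem_extDual_iff.2 ⟨?_, fun Q R hQ hR s t hs ht hst e => ?_⟩
  · refine ContinuousLinearMap.opNorm_le_bound _ zero_le_one fun f => ?_
    refine (p.le_opNorm _).trans ?_
    rw [hp1, one_mul, one_mul, ← J.norm_map]
    exact (J f).norm_coe_le_norm x
  -- On `M (C v)` the functional `evalDual J x p` takes the value `p v`, so `e` restricts to a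
  -- convex decomposition of `p`, which is extreme.
  have hloc : ∀ M : A →L[K] A, (∀ f, ‖M f‖ ≤ ‖f‖) → (∀ f, J (M f) x = J f x) →
      ∀ v, Q (M (C v)) = p v := by
    intro M hM1 hMx v
    have hn : ∀ Q : StrongDual K A, ‖Q‖ ≤ 1 → ‖(Q.comp M).comp C‖ ≤ 1 := fun Q hQ =>
      ContinuousLinearMap.opNorm_le_bound _ zero_le_one fun v => by
        refine (Q.le_of_opNorm_le hQ _).trans ?_
        rw [one_mul, one_mul]
        exact (hM1 _).trans (hCn v)
    have h1 := hp2 _ _ (hn Q hQ) (hn R hR) s t hs ht hst (by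
      ext w
      have := congrArg (fun Φ : StrongDual K A => Φ (M (C w))) e
      simpa [hMx, hC] using this)
    exact congrArg (fun Φ : StrongDual K E => Φ v) h1
  have hQC : ∀ v, Q (C v) = p v :=
    hloc (ContinuousLinearMap.id K A) (fun _ => le_rfl) fun _ => rfl
  have hvan : ∀ f : A, J f x = 0 → Q f = 0 := by
    intro f hf
    have hsmall : ∀ ε : ℝ, 0 < ε → ‖Q f‖ ≤ ε := by
      intro ε hε
      -- The multiplier `1 - ‖f‖/ε`, truncated, is `1` at `x` and `0` where `‖f‖ ≥ ε`.
      obtain ⟨M, hM⟩ := hJ.exists_mul 1 (-ε⁻¹) f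
      have hMw : IsConvexWeight M :=
        isConvexWeight_of_apply_eq (fun _ => unitClamp_nonneg _) (fun _ => unitClamp_le_one _) hM
      have hM1 : ∀ f, ‖M f‖ ≤ ‖f‖ := fun f => by simpa using hMw f 0
      have hMx : ∀ b, J (M b) x = J b x := fun b => by
        rw [hM, hf, norm_zero, mul_zero, add_zero, unitClamp_of_one_le le_rfl, RCLike.ofReal_one,
          one_smul]
      have hQM := hloc M hM1 hMx
      have hge : 1 ≤ ‖Q.comp M‖ := by
        rw [← hp1]
        refine ContinuousLinearMap.opNorm_le_bound _ (norm_nonneg _) fun v => ?_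
        rw [← hQM v]
        exact ((Q.comp M).le_opNorm (C v)).trans
          (mul_le_mul_of_nonneg_left (hCn v) (norm_nonneg _))
      -- `Q ∘ M` already exhausts the norm of `Q`, so nothing is left for the complement.
      have hzero : Q.comp (ContinuousLinearMap.id K A - M) = 0 := by
        have := hMw.norm_comp_add_norm_comp_le Q
        exact norm_le_zero_iff.1 (by linarith)
      have hQf : Q f = Q (M f) := by
        have := congrArg (fun Φ : StrongDual K A => Φ f) hzero
        simpa [sub_eq_zero] using this
      rw [hQf]
      refine (Q.le_of_opNorm_le hQ _).trans ?_
      rw [one_mul, ← J.norm_map]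
      refine (BoundedContinuousFunction.norm_le hε.le).2 fun z => ?_
      rw [hM, norm_smul, RCLike.norm_ofReal, abs_of_nonneg (unitClamp_nonneg _)]
      rcases le_or_gt ‖J f z‖ ε with h | h
      · exact (mul_le_of_le_one_left (norm_nonneg _) (unitClamp_le_one _)).trans h
      · rw [unitClamp_of_nonpos, zero_mul]
        · exact hε.le
        · have : 1 ≤ ε⁻¹ * ‖J f z‖ := by rw [le_inv_mul_iff₀ hε]; linarith
          linarith
    exact norm_le_zero_iff.1 (le_of_forall_pos_le_add fun ε hε => by simpa using hsmall ε hε)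
  ext f
  have h1 := hvan (f - C (J f x)) (by simp [hC])
  rw [map_sub, hQC, sub_eq_zero] at h1
  exact h1

/-- A linear isometry carries a multiplication operator to a pointwise scalar operator. -/
theorem IsLocalModule.exists_apply_conj_eq_smul (hI : IsLocalModule I)
    (hF : Module.finrank K (centralizer K F) = 1) (T : A ≃ₗᵢ[K] B) {M : A →L[K] A}
    (hM : IsConvexWeight M) (y : Y) : ∃ c : K, ∀ f : A, I (T (M f)) y = c • I (T f) y := by
  have : Nontrivial F := nontrivial_of_finrank_centralizer hF
  obtain ⟨C, hC⟩ := hI.exists_const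
  have heig : ∀ p ∈ extDual K F, ∃ r : ℝ, ∀ f, p (I (T (M f)) y) = (r : K) * p (I (T f) y) :=
    fun p hp => hM.exists_eigenvalue (comp_mem_extDual T (hI.evalDual_mem_extDual y hp))
  let N : F →L[K] F := (BoundedContinuousFunction.evalCLM K y).comp
    (I.toContinuousLinearMap.comp ((T.toContinuousLinearEquiv : A →L[K] B).comp
      (M.comp ((T.symm.toContinuousLinearEquiv : B →L[K] A).comp C))))
  have hN : ∀ v, N v = I (T (M (T.symm (C v)))) y := fun _ => rfl
  obtain ⟨c, hc⟩ := exists_eq_smul_of_finrank_centralizer hF (N := N) fun p hp => by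
    obtain ⟨r, hr⟩ := heig p hp
    refine ⟨r, fun v => ?_⟩
    rw [hN, hr, T.apply_symm_apply, hC]
  refine ⟨c, fun f => sub_eq_zero.1 (eq_zero_of_forall_extDual (K := K) fun p hp => ?_)⟩
  obtain ⟨r, hr⟩ := heig p hp
  -- Under `T`, this function and `f` have images with the same value at `y`, so the eigenvalue
  -- relation for `p` treats them alike.
  have h1 := hr (T.symm (C (I (T f) y)))
  rw [← hN, hc, T.apply_symm_apply, hC] at h1
  rw [map_sub, hr, h1, sub_self]

theorem IsLocalModule.cozero_inter_eq_empty (hJ : IsLocalModule J) (hI : IsLocalModule I)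
    (hF : Module.finrank K (centralizer K F) = 1) (T : A ≃ₗᵢ[K] B) {f g : A}
    (hfg : cozero (J f) ∩ cozero (J g) = ∅) : cozero (I (T f)) ∩ cozero (I (T g)) = ∅ := by
  refine Set.eq_empty_of_forall_notMem fun y ⟨hfy, hgy⟩ => hfy ?_
  have hsmall : ∀ ε : ℝ, 0 < ε → ‖I (T f) y‖ ≤ ε := by
    intro ε hε
    -- The multiplier is `0` where `f` vanishes, in particular on the cozero set of `g`, and `1`
    -- where `‖f‖ ≥ ε`.
    obtain ⟨M, hM⟩ := hJ.exists_mul 0 ε⁻¹ f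
    have hMw : IsConvexWeight M :=
      isConvexWeight_of_apply_eq (fun _ => unitClamp_nonneg _) (fun _ => unitClamp_le_one _) hM
    obtain ⟨c, hc⟩ := hI.exists_apply_conj_eq_smul hF T hMw y
    have hMg : M g = 0 := J.injective (BoundedContinuousFunction.ext fun x => by
      rw [hM, map_zero, BoundedContinuousFunction.coe_zero, Pi.zero_apply]
      by_cases hx : J f x = 0
      · rw [hx, norm_zero, mul_zero, add_zero, unitClamp_of_nonpos le_rfl, RCLike.ofReal_zero,
          zero_smul]
      · have hgx : J g x = 0 := by
          by_contra hgx
          exact (hfg ▸ (⟨hx, hgx⟩ : x ∈ cozero (J f) ∩ cozero (J g)) : x ∈ (∅ : Set X))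
        rw [hgx, smul_zero])
    have hc0 : c = 0 := by
      have := hc g
      rw [hMg, map_zero, map_zero, BoundedContinuousFunction.coe_zero, Pi.zero_apply, eq_comm,
        smul_eq_zero] at this
      exact this.resolve_right hgy
    have hTf : I (T f) y = I (T (f - M f)) y := by
      rw [map_sub, map_sub, BoundedContinuousFunction.sub_apply, hc f, hc0, zero_smul, sub_zero]
    rw [hTf]
    refine ((I (T (f - M f))).norm_coe_le_norm y).trans ?_
    rw [I.norm_map, T.norm_map, ← J.norm_map]
    refine (BoundedContinuousFunction.norm_le hε.le).2 fun x => ?_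
    rw [map_sub, BoundedContinuousFunction.sub_apply, hM, zero_add]
    rcases le_or_gt ‖J f x‖ ε with h | h
    · have e : J f x - (unitClamp (ε⁻¹ * ‖J f x‖) : K) • J f x =
          ((1 - unitClamp (ε⁻¹ * ‖J f x‖) : ℝ) : K) • J f x := by
        rw [RCLike.ofReal_sub, RCLike.ofReal_one, sub_smul, one_smul]
      rw [e, norm_smul, RCLike.norm_ofReal, abs_of_nonneg (sub_nonneg.2 (unitClamp_le_one _))]
      refine (mul_le_of_le_one_left (norm_nonneg _) ?_).trans h
      linarith [unitClamp_nonneg (ε⁻¹ * ‖J f x‖)]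
    · rw [unitClamp_of_one_le, RCLike.ofReal_one, one_smul, sub_self, norm_zero]
      · exact hε.le
      · rw [le_inv_mul_iff₀ hε]; linarith
  exact norm_le_zero_iff.1 (le_of_forall_pos_le_add fun ε hε => by simpa using hsmall ε hε)

theorem isLocalModule_id : IsLocalModule (LinearIsometry.id : (X →ᵇ E) →ₗᵢ[K] (X →ᵇ E)) where
  const v := ⟨BoundedContinuousFunction.const X v, fun _ => rfl⟩
  mul α β a b := by
    refine ⟨BoundedContinuousFunction.ofNormedAddCommGroup
      (fun x => (unitClamp (α + β * ‖a x‖) : K) • b x) ?_ ‖b‖ fun x => ?_, fun _ => rfl⟩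
    · have := lipschitzWith_unitClamp.continuous
      exact (RCLike.continuous_ofReal.comp (this.comp (by fun_prop))).smul b.continuous
    · rw [norm_smul, RCLike.norm_ofReal, abs_of_nonneg (unitClamp_nonneg _)]
      exact (mul_le_of_le_one_left (norm_nonneg _) (unitClamp_le_one _)).trans
        (b.norm_coe_le_norm x)

theorem isLocalModule_boundedUniform {X : Type*} [PseudoMetricSpace X] :
    IsLocalModule (boundedUniform K X E).subtypeₗᵢ where
  const v := ⟨⟨BoundedContinuousFunction.const X v, uniformContinuous_const⟩, fun _ => rfl⟩
  mul α β a b := by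
    obtain ⟨c, hc⟩ := (isLocalModule_id (K := K)).mul α β (a : X →ᵇ E) (b : X →ᵇ E)
    refine ⟨⟨c, ?_⟩, hc⟩
    have ha : UniformContinuous (a : X →ᵇ E) := a.2
    have hb : UniformContinuous (b : X →ᵇ E) := b.2
    have hh : UniformContinuous fun x => unitClamp (α + β * ‖(a : X →ᵇ E) x‖) :=
      lipschitzWith_unitClamp.uniformContinuous.comp
        (uniformContinuous_const.add ((uniformContinuous_norm.comp ha).const_smul β))
    change UniformContinuous c
    rw [Metric.uniformContinuous_iff] at hh hb ⊢
    intro ε hε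
    -- The `+ 1` keeps the denominator positive when `b = 0`.
    have hd : 0 < ε / (2 * (‖(b : X →ᵇ E)‖ + 1)) := by positivity
    obtain ⟨δ, hδ, h1⟩ := hh _ hd
    obtain ⟨η, hη, h2⟩ := hb (ε / 2) (by positivity)
    refine ⟨min δ η, lt_min hδ hη, fun {x z} hxz => ?_⟩
    have h1 := h1 (hxz.trans_le (min_le_left _ _))
    have h2 := h2 (hxz.trans_le (min_le_right _ _))
    rw [Real.dist_eq] at h1
    rw [dist_eq_norm] at h2 ⊢
    have hcx := hc x
    have hcz := hc z
    simp only [LinearIsometry.id_apply] at hcx hcz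
    set r := unitClamp (α + β * ‖(a : X →ᵇ E) x‖) with hr
    set s := unitClamp (α + β * ‖(a : X →ᵇ E) z‖) with hs
    have e : c x - c z = (r : K) • ((b : X →ᵇ E) x - (b : X →ᵇ E) z) +
        ((r - s : ℝ) : K) • (b : X →ᵇ E) z := by
      rw [hcx, hcz, RCLike.ofReal_sub]
      module
    rw [e]
    refine (norm_add_le _ _).trans_lt ?_
    rw [norm_smul, norm_smul, RCLike.norm_ofReal, RCLike.norm_ofReal,
      abs_of_nonneg (unitClamp_nonneg _)]
    have h3 : r * ‖(b : X →ᵇ E) x - (b : X →ᵇ E) z‖ < ε / 2 :=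
      (mul_le_of_le_one_left (norm_nonneg _) (unitClamp_le_one _)).trans_lt h2
    have h4 : |r - s| * ‖(b : X →ᵇ E) z‖ ≤ ε / 2 := by
      have h5 : ‖(b : X →ᵇ E) z‖ ≤ ‖(b : X →ᵇ E)‖ + 1 :=
        ((b : X →ᵇ E).norm_coe_le_norm z).trans (by linarith)
      refine (mul_le_mul h1.le h5 (norm_nonneg _) hd.le).trans (le_of_eq ?_)
      have : ‖(b : X →ᵇ E)‖ + 1 ≠ 0 := by positivity
      field_simp
    linarith

end FunctionModules

end BanachStone

theorem proposition3p5 {K : Type*} [RCLike K] {E F : Type*}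
    [NormedAddCommGroup E] [NormedSpace K E] [CompleteSpace E]
    [NormedAddCommGroup F] [NormedSpace K F] [CompleteSpace F]
    (hE : Module.finrank K (BanachStone.centralizer K E) = 1)
    (hF : Module.finrank K (BanachStone.centralizer K F) = 1) :
    (∀ (X Y : Type*) [TopologicalSpace X] [T35Space X] [TopologicalSpace Y] [T35Space Y],
      BanachStone.IsRealcompact X → BanachStone.IsRealcompact Y →
      ¬ FiniteDimensional K E → ¬ FiniteDimensional K F →
      ∀ T : (X →ᵇ E) →ₗᵢ[K] (Y →ᵇ F), Function.Surjective T →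
        BanachStone.IsBiseparating T) ∧
    (∀ (X Y : Type*) [MetricSpace X] [CompleteSpace X] [MetricSpace Y] [CompleteSpace Y],
      ∀ T : BanachStone.boundedUniform K X E →ₗᵢ[K] BanachStone.boundedUniform K Y F,
        Function.Surjective T → BanachStone.IsBiseparating T) := by
  refine ⟨fun X Y _ _ _ _ _ _ _ _ T hT => ?_, fun X Y _ _ _ _ T hT => ?_⟩
  · let e := LinearIsometryEquiv.ofSurjective T hT
    exact ⟨⟨T.map_add, fun f g hfg => BanachStone.isLocalModule_id.cozero_inter_eq_empty
        BanachStone.isLocalModule_id hF e hfg⟩, e.symm, e.symm_apply_apply, e.apply_symm_apply,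
      e.symm.map_add, fun f g hfg => BanachStone.isLocalModule_id.cozero_inter_eq_empty
        BanachStone.isLocalModule_id hE e.symm hfg⟩
  · let e := LinearIsometryEquiv.ofSurjective T hT
    exact ⟨⟨T.map_add, fun f g hfg =>
        BanachStone.isLocalModule_boundedUniform.cozero_inter_eq_empty
        BanachStone.isLocalModule_boundedUniform hF e hfg⟩,
      e.symm, e.symm_apply_apply, e.apply_symm_apply, e.symm.map_add, fun f g hfg =>
        BanachStone.isLocalModule_boundedUniform.cozero_inter_eq_empty
        BanachStone.isLocalModule_boundedUniform hE e.symm hfg⟩
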